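/- **Setting.** Let $d,C\ge 1$ be integers and $\varepsilon,L_y,p_{\min},p_{\max},\rho,r_0>0$. The features $x_1,\dots,x_n$ are i.i.d. from a law $P_X$ with Lebesgue density $p$ on $\mathbb R^d$, and they lie almost surely in a measurable set $\mathcal X\subset\mathbb R^d$ that is a *valid region* for $p$: $\mathcal X$ is connected, $p_{\min}\le p(x)\le p_{\max}$ for all $x\in\mathcal X$, and $\mathrm{vol}(B_r(x)\cap\mathcal X)\ge\rho\,\mathrm{vol}(B_r(x))$ for all $x\in\mathcal X$ and $0<r<r_0$. The soft labels $p_q=(P(y=c\mid x_q))_{c=1}^C$ come from a conditional distribution of $y\in\{1,\dots,C\}$ with $\|P(\cdot\mid x)-P(\cdot\mid x')\|_2\le L_y\|x-x'\|_2$ for $x,x'\in\mathcal X$. Given the features, $m$ annotation queries are made independently: the $j$-th one draws an index $i_j\in\{1,\dots,n\}$ uniformly and then a class $c_j\sim P(\cdot\mid x_{i_j})$, with one-hot encoding $y_j\in\{0,1\}^C$. **Algorithm.** Put $$\alpha_n=1-n^{-1/(d+1)},\qquad h_n=\frac{\varepsilon}{3L_y\,\lceil \log_{\alpha_n}(\varepsilon/(12\sqrt2))\rceil}$$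 (a quotient with denominator $0$ is read as $0$; this concerns only large $\varepsilon$, for which the claims about $\hat p_q$ are trivial). Let $W_{ij}=1$ if $i\ne j$ and $\|x_i-x_j\|<h_n$, and $W_{ij}=0$ otherwise; let $D$ be the diagonal matrix of the degrees $\sum_jW_{ij}$ and $S=D^{-1}W$ (with a zero row at isolated vertices). Probabilistic label spreading returns $$\hat p_q=\frac{\sum_{j=1}^m (I-\alpha_nS)^{-1}_{q,i_j}\,y_j}{\sum_{j=1}^m (I-\alpha_nS)^{-1}_{q,i_j}},\qquad q=1,\dots,n,$$ and the uniform label $(1/C,\dots,1/C)$ if the denominator is $0$. **Theorem.** We have $\alpha_n\to1$ and $h_n\to0$ as $n\to\infty$, and the following hold with constants that depend only on $d,C,\varepsilon,L_y,p_{\min},p_{\max}$ and the region constants $\rho,r_0$. 1. There are $\zeta>0$ and $N$ such that for all $n\ge N$, all budgets $m\le n^{1+\frac1{2(d+1)}}$ (in particular all $m\le n$), and all data distributions as above, $$P\big(\exists\,q\in\{1,\dots,n\}:\ \|\hat p_q-p_q\|_2>\varepsilon\big)\ \le\ 12\,n\,C\,\exp\Big(-\zeta\,\frac{m}{n^{1-\frac1{2(d+1)}}}\Big).$$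 2. There is $K>0$ such that for every $\delta\in(0,1)$ there is $N$ (which may depend on $\delta$ as well) such that for all $n\ge N$, all budgets $m\ge K\,n^{1-\frac1{2(d+1)}}\log n$, and all data distributions as above, $$P\big(\exists\,q\in\{1,\dots,n\}:\ \|\hat p_q-p_q\|_2>\varepsilon\big)\le\delta .$$ Here the smallest such budget satisfies $\lceil K\,n^{1-\frac1{2(d+1)}}\log n\rceil/n\to0$: the number of annotations per point may tend to zero. -/

import Mathlib

open MeasureTheory ProbabilityTheory Filter Topology
open scoped ENNReal

noncomputable section

namespace PLS

/-- The space `ℝ^d` with its Euclidean norm. -/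
abbrev Feature (d : ℕ) : Type := EuclideanSpace ℝ (Fin d)

/-! ### The graph and the estimator -/

/-- Affinity matrix of the unweighted `h`-ball graph on the points `x 0, …, x (n-1)`, without
self-loops. -/
def affinity {d n : ℕ} (h : ℝ) (x : Fin n → Feature d) : Matrix (Fin n) (Fin n) ℝ :=
  Matrix.of fun i j => if i ≠ j ∧ ‖x i - x j‖ < h then 1 else 0

/-- Vertex degrees of the `h`-ball graph. -/
def degree {d n : ℕ} (h : ℝ) (x : Fin n → Feature d) (i : Fin n) : ℝ :=
  ∑ j, affinity h x i j

/-- Random-walk normalisation `S = D⁻¹ W`. The row of an isolated vertex is zero. -/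
def transition {d n : ℕ} (h : ℝ) (x : Fin n → Feature d) : Matrix (Fin n) (Fin n) ℝ :=
  Matrix.diagonal (fun i => (degree h x i)⁻¹) * affinity h x

/-- The heat kernel `(I - α S)⁻¹`; its `(q, j)` entry is the propagation score which `x q`
receives from an annotation of `x j`. -/
def heatKernel {d n : ℕ} (α h : ℝ) (x : Fin n → Feature d) : Matrix (Fin n) (Fin n) ℝ :=
  (1 - α • transition h x)⁻¹

/-- The total propagation score received by `x q` from the queries `w`, where `w j = (i, c)` says
that the `j`-th query annotated the point `x i` with the class `c`. -/
def totalScore {d n C m : ℕ} (α h : ℝ) (x : Fin n → Feature d) (w : Fin m → Fin n × Fin C)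
    (q : Fin n) : ℝ :=
  ∑ j, heatKernel α h x q (w j).1

/-- The soft label of `x q` estimated by probabilistic label spreading: the average of the one-hot
encoded annotations weighted by the propagation scores, and the uniform label if `x q` has
received no information. -/
def estimate {d n C m : ℕ} (α h : ℝ) (x : Fin n → Feature d) (w : Fin m → Fin n × Fin C)
    (q : Fin n) : EuclideanSpace ℝ (Fin C) :=
  WithLp.toLp 2 fun c =>
    if totalScore α h x w q = 0 then (C : ℝ)⁻¹
    else (∑ j, heatKernel α h x q (w j).1 * (if (w j).2 = c then 1 else 0)) /
      totalScore α h x w q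

/-! ### The sampling model -/

/-- The soft label `P(y | x)` as a vector. -/
def softLabel {d C : ℕ} (κ : Kernel (Feature d) (Fin C)) (x : Feature d) :
    EuclideanSpace ℝ (Fin C) :=
  WithLp.toLp 2 fun c => (κ x).real {c}

/-- The law with Lebesgue density `p`. -/
def featureLaw {d : ℕ} (p : Feature d → ℝ) : Measure (Feature d) :=
  volume.withDensity fun x => ENNReal.ofReal (p x)

/-- The law of one annotation query, given the features `x`: an index `i` is drawn uniformly, then
a class is drawn from `P(y | x i)`. -/
def queryLaw {d n C : ℕ} (κ : Kernel (Feature d) (Fin C)) (x : Fin n → Feature d) :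
    Measure (Fin n × Fin C) :=
  (uniformOn Set.univ : Measure (Fin n)) ⊗ₘ (κ.comap x (measurable_of_countable x))

instance {d n C : ℕ} (κ : Kernel (Feature d) (Fin C)) [IsMarkovKernel κ]
    (x : Fin n → Feature d) : IsFiniteMeasure (queryLaw κ x) := by
  unfold queryLaw
  infer_instance

theorem queryLaw_singleton {d n C : ℕ} (κ : Kernel (Feature d) (Fin C)) [IsMarkovKernel κ]
    (x : Fin n → Feature d) (i : Fin n) (c : Fin C) :
    queryLaw κ x {(i, c)} = κ (x i) {c} * (uniformOn Set.univ : Measure (Fin n)) {i} := by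
  rw [queryLaw, ← Set.singleton_prod_singleton,
    Measure.compProd_apply_prod (measurableSet_singleton _) (measurableSet_singleton _),
    lintegral_singleton, Kernel.comap_apply]

/-- Given the features, the `m` queries are independent with law `queryLaw`. -/
def queriesKernel {d C : ℕ} (κ : Kernel (Feature d) (Fin C)) [IsMarkovKernel κ] (n m : ℕ) :
    Kernel (Fin n → Feature d) (Fin m → Fin n × Fin C) where
  toFun x := Measure.pi fun _ => queryLaw κ x
  measurable' := by
    classical
    refine Measure.measurable_of_measurable_coe _ fun s _ => ?_
    have key : ∀ x : Fin n → Feature d, (Measure.pi (fun _ : Fin m => queryLaw κ x)) s =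
        ∑ w ∈ s.toFinset, ∏ j, κ (x (w j).1) {(w j).2} *
          (uniformOn Set.univ : Measure (Fin n)) {(w j).1} := by
      intro x
      have h := sum_measure_singleton (s := s.toFinset)
        (μ := Measure.pi (fun _ : Fin m => queryLaw κ x))
      rw [Set.coe_toFinset] at h
      rw [← h]
      refine Finset.sum_congr rfl fun w _ => ?_
      rw [Measure.pi_singleton]
      exact Finset.prod_congr rfl fun j _ => queryLaw_singleton κ x (w j).1 (w j).2
    simp_rw [key]
    refine Finset.measurable_sum _ fun w _ => Finset.measurable_prod _ fun j _ => ?_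
    refine Measurable.mul_const ?_ _
    exact (κ.measurable_coe (measurableSet_singleton _)).comp (measurable_pi_apply _)

/-- The joint law of `n` i.i.d. features with law `PX` and of `m` annotation queries. -/
def sampleLaw {d C : ℕ} (PX : Measure (Feature d)) (κ : Kernel (Feature d) (Fin C))
    [IsMarkovKernel κ] (n m : ℕ) :
    Measure ((Fin n → Feature d) × (Fin m → Fin n × Fin C)) :=
  (Measure.pi fun _ : Fin n => PX) ⊗ₘ queriesKernel κ n m

/-! ### The assumptions -/

/-- `𝒳` is a valid region for the density `p`: connected, with `p` between `pmin` and `pmax` on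
`𝒳`, and containing at least the fraction `ρ` of each ball of radius below `r₀` centred in it. -/
structure IsValidRegion {d : ℕ} (p : Feature d → ℝ) (𝒳 : Set (Feature d))
    (pmin pmax ρ r₀ : ℝ) : Prop where
  measurableSet : MeasurableSet 𝒳
  isConnected : IsConnected 𝒳
  density_bounds : ∀ x ∈ 𝒳, pmin ≤ p x ∧ p x ≤ pmax
  ball_fraction : ∀ r : ℝ, 0 < r → r < r₀ → ∀ x ∈ 𝒳,
    ENNReal.ofReal ρ * volume (Metric.ball x r) ≤ volume (Metric.ball x r ∩ 𝒳)

/-- The assumptions on the data distribution: the features have a probability density `p` and lie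
in `𝒳`, which is a valid region for `p`, and `x ↦ P(y | x)` is `L`-Lipschitz on `𝒳`. -/
structure Assumptions {d C : ℕ} (𝒳 : Set (Feature d)) (p : Feature d → ℝ)
    (κ : Kernel (Feature d) (Fin C)) (pmin pmax ρ r₀ L : ℝ) : Prop where
  measurable_density : Measurable p
  density_nonneg : ∀ x, 0 ≤ p x
  isProbabilityMeasure : IsProbabilityMeasure (featureLaw p)
  supported : featureLaw p 𝒳ᶜ = 0
  validRegion : IsValidRegion p 𝒳 pmin pmax ρ r₀
  lipschitz : ∀ x ∈ 𝒳, ∀ x' ∈ 𝒳, ‖softLabel κ x - softLabel κ x'‖ ≤ L * ‖x - x'‖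

/-! ### The choice of the parameters -/

/-- Spreading intensity `α_n = 1 - n^{-1/(d+1)}`. -/
def spreadingIntensity (d n : ℕ) : ℝ := 1 - (n : ℝ) ^ (-(1 / ((d : ℝ) + 1)))

/-- Bandwidth `h_n = ε / (3 L ⌈log_{α_n} (ε / (12 √2))⌉)`. -/
def bandwidth (d : ℕ) (ε L : ℝ) (n : ℕ) : ℝ :=
  ε / (3 * L * (⌈Real.logb (spreadingIntensity d n) (ε / (12 * √2))⌉ : ℝ))

/-- `n^{1 - 1/(2(d+1))}`. -/
def budgetScale (d n : ℕ) : ℝ := (n : ℝ) ^ (1 - 1 / (2 * ((d : ℝ) + 1)))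

/-- The event that some estimated soft label is off by more than `ε`, when label spreading is run
with intensity `spreadingIntensity d n` on the graph with bandwidth `bandwidth d ε L n`. -/
def failure {d C : ℕ} (κ : Kernel (Feature d) (Fin C)) (ε L : ℝ) (n m : ℕ) :
    Set ((Fin n → Feature d) × (Fin m → Fin n × Fin C)) :=
  {s | ∃ q : Fin n,
    ε < ‖estimate (spreadingIntensity d n) (bandwidth d ε L n) s.1 s.2 q
      - softLabel κ (s.1 q)‖}

end PLS

end

/-! Put t = (1 - α_n)⁻¹ = n^{1/(d+1)} and condition on the features. If no vertex is isolated, the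
rows of the heat kernel are nonnegative with sum t, so the estimate is a weighted average of labels,
and its error splits into bias and fluctuation. Bias: in the Neumann expansion, walks of fewer than
K = ⌈log_{α_n}(ε/(12√2))⌉ steps stay within K h_n = ε/(3L) of the start and cost at most ε/3 by the
Lipschitz bound; the tail costs at most α_n^K √2 ≤ ε/12 (`norm_sum_resolvent_smul_le`). Fluctuation:
K is of order at most t, so h_n is at least of order 1/t and expected degrees are at least of order
n t^{-d} = t. A Chernoff bound makes this hold for all degrees (`measureReal_degree_le`), and then
all kernel entries are at most a constant (`resolvent_apply_le`). A single query's score has mean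
t/n and, being bounded, second moment of the same order, so Bernstein (`measureReal_sum_ge_le`)
gives failure probability exp(-a m t/n) per statistic. Union bounds yield n exp(-a t) + 3nC exp(-a m
t/n) in `exists_failure_bound`; both claims follow by comparing exponents via s = √t, since the
budget scale is n/s. -/

namespace PLS

/-! ### Resolvents of (sub)stochastic matrices -/

section Resolvent

theorem sum_mul_apply {ι : Type*} [Fintype ι] {A B : Matrix ι ι ℝ} {b : ℝ}
    (hB : ∀ i, ∑ j, B i j = b) (i : ι) :
    ∑ j, (A * B) i j = (∑ j, A i j) * b := by
  simp_rw [Matrix.mul_apply]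
  rw [Finset.sum_comm, Finset.sum_mul]
  exact Finset.sum_congr rfl fun k _ => by rw [← Finset.mul_sum, hB]

variable {ι : Type*} [Fintype ι] [DecidableEq ι] {S : Matrix ι ι ℝ} {α : ℝ}

/-- Minimum principle for the resolvent of a substochastic matrix. -/
theorem nonneg_of_one_sub_smul_mulVec_nonneg (hS : ∀ i j, 0 ≤ S i j)
    (hS1 : ∀ i, ∑ j, S i j ≤ 1) (hα0 : 0 ≤ α) (hα1 : α < 1) {v : ι → ℝ}
    (hv : ∀ i, 0 ≤ ((1 - α • S).mulVec v) i) (i : ι) : 0 ≤ v i := by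
  have : Nonempty ι := ⟨i⟩
  obtain ⟨k, hk⟩ := Finite.exists_min v
  refine le_trans ?_ (hk i)
  by_contra! hneg
  have h1 := hv k
  rw [Matrix.sub_mulVec, Matrix.one_mulVec, Matrix.smul_mulVec] at h1
  simp only [Pi.sub_apply, Pi.smul_apply, smul_eq_mul, Matrix.mulVec, dotProduct] at h1
  -- At a negative minimum, a row of mass at most 1 averages `v` to at least `v k`. Then `v k ≥ α *
  -- v k`, which is impossible for `α < 1`.
  have h2 : v k ≤ ∑ j, S k j * v j := by
    calc v k ≤ (∑ j, S k j) * v k := by nlinarith [hS1 k]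
      _ = ∑ j, S k j * v k := Finset.sum_mul ..
      _ ≤ _ := Finset.sum_le_sum fun j _ => mul_le_mul_of_nonneg_left (hk j) (hS k j)
  nlinarith [mul_le_mul_of_nonneg_left h2 hα0]

/-- The minimum principle applies to both `v` and `-v` when `v` is in the kernel. -/
theorem isUnit_det_one_sub_smul (hS : ∀ i j, 0 ≤ S i j)
    (hS1 : ∀ i, ∑ j, S i j ≤ 1) (hα0 : 0 ≤ α) (hα1 : α < 1) :
    IsUnit (1 - α • S).det := by
  rw [isUnit_iff_ne_zero, ne_eq, ← Matrix.exists_mulVec_eq_zero_iff]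
  rintro ⟨v, hv0, hv⟩
  refine hv0 (funext fun i => le_antisymm ?_ ?_)
  · have := nonneg_of_one_sub_smul_mulVec_nonneg hS hS1 hα0 hα1 (v := -v)
      (by simp [Matrix.mulVec_neg, hv]) i
    simpa using this
  · exact nonneg_of_one_sub_smul_mulVec_nonneg hS hS1 hα0 hα1 (by simp [hv]) i

theorem resolvent_nonneg (hS : ∀ i j, 0 ≤ S i j)
    (hS1 : ∀ i, ∑ j, S i j ≤ 1) (hα0 : 0 ≤ α) (hα1 : α < 1) (i j : ι) :
    0 ≤ (1 - α • S)⁻¹ i j := by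
  refine nonneg_of_one_sub_smul_mulVec_nonneg hS hS1 hα0 hα1
    (v := fun i => (1 - α • S)⁻¹ i j) (fun k => ?_) i
  have h := congrFun (congrFun
    (Matrix.mul_nonsing_inv _ (isUnit_det_one_sub_smul hS hS1 hα0 hα1)) k) j
  rw [Matrix.mul_apply] at h
  simp only [Matrix.mulVec, dotProduct]
  rw [h, Matrix.one_apply]
  split_ifs <;> simp

/-- The constant vector is an eigenvector of `1 - α • S` with eigenvalue `1 - α`. -/
theorem resolvent_row_sum (hS : ∀ i j, 0 ≤ S i j)
    (hS1 : ∀ i, ∑ j, S i j = 1) (hα0 : 0 ≤ α) (hα1 : α < 1) (i : ι) :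
    ∑ j, (1 - α • S)⁻¹ i j = (1 - α)⁻¹ := by
  have hu := isUnit_det_one_sub_smul hS (fun i => (hS1 i).le) hα0 hα1
  have h1 : (1 - α • S).mulVec (fun _ => (1 : ℝ)) = (1 - α) • fun _ => (1 : ℝ) := by
    ext k
    rw [Matrix.sub_mulVec, Matrix.one_mulVec, Matrix.smul_mulVec]
    simp [Matrix.mulVec, dotProduct, hS1]
  have h2 := congrArg ((1 - α • S)⁻¹.mulVec) h1
  rw [Matrix.mulVec_mulVec, Matrix.nonsing_inv_mul _ hu, Matrix.one_mulVec,
    Matrix.mulVec_smul] at h2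
  have h3 := congrFun h2 i
  simp only [Pi.smul_apply, Matrix.mulVec, dotProduct, mul_one, smul_eq_mul] at h3
  rw [eq_inv_of_mul_eq_one_right h3.symm]

theorem resolvent_eq_one_add_mul (hu : IsUnit (1 - α • S).det) :
    (1 - α • S)⁻¹ = 1 + α • (S * (1 - α • S)⁻¹) := by
  have h := Matrix.mul_nonsing_inv _ hu
  rw [sub_mul, one_mul, smul_mul_assoc] at h
  exact sub_eq_iff_eq_add.mp h

/-- With `S` on the right, R = 1 + α R S bounds each entry by 1 plus a row sum of R times the
largest entry of `S`. Large degrees thus keep all scores bounded. -/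
theorem resolvent_apply_le (hS : ∀ i j, 0 ≤ S i j)
    (hS1 : ∀ i, ∑ j, S i j = 1) (hα0 : 0 ≤ α) (hα1 : α < 1) {s : ℝ} (hs : ∀ i j, S i j ≤ s)
    (i j : ι) : (1 - α • S)⁻¹ i j ≤ 1 + (1 - α)⁻¹ * s := by
  have hs0 : 0 ≤ s := (hS i j).trans (hs i j)
  have hu := isUnit_det_one_sub_smul hS (fun i => (hS1 i).le) hα0 hα1
  have h := Matrix.nonsing_inv_mul _ hu
  rw [mul_sub, mul_one, mul_smul_comm, sub_eq_iff_eq_add] at h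
  have h1 : (1 - α • S)⁻¹ i j = (1 : Matrix ι ι ℝ) i j
      + α * ∑ k, (1 - α • S)⁻¹ i k * S k j := by
    conv_lhs => rw [h]
    simp [Matrix.mul_apply]
  rw [h1]
  have h2 : ∑ k, (1 - α • S)⁻¹ i k * S k j ≤ (1 - α)⁻¹ * s := by
    rw [← resolvent_row_sum hS hS1 hα0 hα1 i, Finset.sum_mul]
    exact Finset.sum_le_sum fun k _ => mul_le_mul_of_nonneg_left (hs k j)
      (resolvent_nonneg hS (fun i => (hS1 i).le) hα0 hα1 i k)
  have h3 : (1 : Matrix ι ι ℝ) i j ≤ 1 := by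
    rw [Matrix.one_apply]; split_ifs <;> simp
  have h4 : 0 ≤ (1 - α)⁻¹ * s := mul_nonneg (by rw [inv_nonneg]; linarith) hs0
  nlinarith

/-- The Neumann expansion with exact remainder separates short walks from long ones without any
convergence question. -/
theorem resolvent_eq_sum_add (hu : IsUnit (1 - α • S).det) (K : ℕ) :
    (1 - α • S)⁻¹ = ∑ k ∈ Finset.range K, α ^ k • S ^ k + α ^ K • (S ^ K * (1 - α • S)⁻¹) := by
  induction K with
  | zero => simp
  | succ K ih =>
    conv_lhs => rw [ih, resolvent_eq_one_add_mul hu]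
    rw [Finset.sum_range_succ, add_assoc, mul_add, mul_one, smul_add, mul_smul_comm, smul_smul,
      ← mul_assoc, ← pow_succ, ← pow_succ]

theorem pow_apply_nonneg (hS : ∀ i j, 0 ≤ S i j) (k : ℕ) (i j : ι) : 0 ≤ (S ^ k) i j := by
  induction k generalizing j with
  | zero => rw [pow_zero, Matrix.one_apply]; split_ifs <;> simp
  | succ k ih =>
    rw [pow_succ, Matrix.mul_apply]
    exact Finset.sum_nonneg fun l _ => mul_nonneg (ih l) (hS l j)

theorem pow_row_sum (hS1 : ∀ i, ∑ j, S i j = 1) (k : ℕ) (i : ι) : ∑ j, (S ^ k) i j = 1 := by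
  induction k with
  | zero => simp [Matrix.one_apply]
  | succ k ih => rw [pow_succ, sum_mul_apply hS1, ih, one_mul]

/-- The entries of the resolvent average a function which is small on the points reached by the
random walk in fewer than `K` steps. -/
theorem norm_sum_resolvent_smul_le {E : Type*} [NormedAddCommGroup E] [NormedSpace ℝ E]
    (hS : ∀ i j, 0 ≤ S i j) (hS1 : ∀ i, ∑ j, S i j = 1) (hα0 : 0 ≤ α) (hα1 : α < 1)
    {f : ι → E} {a b : ℝ} {K : ℕ} {q : ι} (ha0 : 0 ≤ a)
    (ha : ∀ k < K, ∀ i, (S ^ k) q i ≠ 0 → ‖f i‖ ≤ a) (hb : ∀ i, ‖f i‖ ≤ b) :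
    ‖∑ i, (1 - α • S)⁻¹ q i • f i‖ ≤ (1 - α)⁻¹ * (a + α ^ K * b) := by
  have hS1' : ∀ i, ∑ j, S i j ≤ 1 := fun i => (hS1 i).le
  have hu := isUnit_det_one_sub_smul hS hS1' hα0 hα1
  have hG := resolvent_nonneg hS hS1' hα0 hα1
  have h0 : ∑ i, (1 - α • S)⁻¹ q i • f i
      = ∑ k ∈ Finset.range K, α ^ k • ∑ i, (S ^ k) q i • f i
        + α ^ K • ∑ i, (S ^ K * (1 - α • S)⁻¹) q i • f i := by
    conv_lhs => rw [resolvent_eq_sum_add hu K]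
    simp only [Matrix.add_apply, Matrix.sum_apply, Matrix.smul_apply, smul_eq_mul, add_smul,
      Finset.sum_smul, Finset.sum_add_distrib, Finset.smul_sum, smul_smul]
    rw [Finset.sum_comm]
  have h1 : ∀ k < K, ‖∑ i, (S ^ k) q i • f i‖ ≤ a := by
    intro k hk
    calc ‖∑ i, (S ^ k) q i • f i‖ ≤ ∑ i, (S ^ k) q i * a := by
          refine norm_sum_le_of_le _ fun i _ => ?_
          rw [norm_smul, Real.norm_of_nonneg (pow_apply_nonneg hS k q i)]
          by_cases h : (S ^ k) q i = 0
          · simp [h]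
          · exact mul_le_mul_of_nonneg_left (ha k hk i h) (pow_apply_nonneg hS k q i)
      _ = a := by rw [← Finset.sum_mul, pow_row_sum hS1, one_mul]
  have h2 : ‖∑ i, (S ^ K * (1 - α • S)⁻¹) q i • f i‖ ≤ (1 - α)⁻¹ * b := by
    have hp : ∀ i, 0 ≤ (S ^ K * (1 - α • S)⁻¹) q i := fun i => by
      rw [Matrix.mul_apply]
      exact Finset.sum_nonneg fun l _ => mul_nonneg (pow_apply_nonneg hS K q l) (hG l i)
    calc _ ≤ ∑ i, (S ^ K * (1 - α • S)⁻¹) q i * b := by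
          refine norm_sum_le_of_le _ fun i _ => ?_
          rw [norm_smul, Real.norm_of_nonneg (hp i)]
          exact mul_le_mul_of_nonneg_left (hb i) (hp i)
      _ = _ := by
          rw [← Finset.sum_mul, sum_mul_apply (resolvent_row_sum hS hS1 hα0 hα1),
            pow_row_sum hS1, one_mul]
  have h3 : ∑ k ∈ Finset.range K, α ^ k ≤ (1 - α)⁻¹ := by
    rw [← tsum_geometric_of_lt_one hα0 hα1]
    exact (summable_geometric_of_lt_one hα0 hα1).sum_le_tsum _ fun _ _ => by positivity
  rw [h0]
  calc _ ≤ ∑ k ∈ Finset.range K, α ^ k * a + α ^ K * ((1 - α)⁻¹ * b) := by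
        refine (norm_add_le _ _).trans (add_le_add ?_ ?_)
        · refine norm_sum_le_of_le _ fun k hk => ?_
          rw [norm_smul, Real.norm_of_nonneg (by positivity)]
          exact mul_le_mul_of_nonneg_left (h1 k (Finset.mem_range.mp hk)) (by positivity)
        · rw [norm_smul, Real.norm_of_nonneg (by positivity)]
          exact mul_le_mul_of_nonneg_left h2 (by positivity)
    _ ≤ (1 - α)⁻¹ * a + α ^ K * ((1 - α)⁻¹ * b) := by
        rw [← Finset.sum_mul]
        gcongr
    _ = _ := by ring

end Resolvent

/-! ### The random walk on the ball graph -/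

section Graph

variable {d n : ℕ} {h : ℝ} {x : Fin n → Feature d}

theorem affinity_nonneg (i j : Fin n) : 0 ≤ affinity h x i j := by
  simp only [affinity, Matrix.of_apply]
  split_ifs <;> simp

theorem affinity_le_one (i j : Fin n) : affinity h x i j ≤ 1 := by
  simp only [affinity, Matrix.of_apply]
  split_ifs <;> simp

theorem degree_nonneg (i : Fin n) : 0 ≤ degree h x i :=
  Finset.sum_nonneg fun j _ => affinity_nonneg i j

theorem transition_apply (i j : Fin n) :
    transition h x i j = (degree h x i)⁻¹ * affinity h x i j := by
  rw [transition, Matrix.diagonal_mul]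

theorem transition_nonneg (i j : Fin n) : 0 ≤ transition h x i j := by
  rw [transition_apply]
  exact mul_nonneg (inv_nonneg.mpr (degree_nonneg i)) (affinity_nonneg i j)

theorem transition_row_sum (i : Fin n) :
    ∑ j, transition h x i j = (degree h x i)⁻¹ * degree h x i := by
  simp_rw [transition_apply]
  rw [← Finset.mul_sum, degree]

theorem transition_row_sum_le (i : Fin n) : ∑ j, transition h x i j ≤ 1 := by
  rw [transition_row_sum]
  exact inv_mul_le_one

theorem transition_row_sum_eq {i : Fin n} (hi : 0 < degree h x i) :
    ∑ j, transition h x i j = 1 := by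
  rw [transition_row_sum, inv_mul_cancel₀ hi.ne']

theorem transition_le {b : ℝ} (hb : 0 < b) {i : Fin n} (hi : b ≤ degree h x i) (j : Fin n) :
    transition h x i j ≤ b⁻¹ := by
  rw [transition_apply]
  calc _ ≤ (degree h x i)⁻¹ * 1 :=
        mul_le_mul_of_nonneg_left (affinity_le_one i j) (inv_nonneg.mpr (degree_nonneg i))
    _ ≤ b⁻¹ := by rw [mul_one]; exact inv_anti₀ hb hi

/-- Each edge has length below `h`, so the triangle inequality localises the walk. -/
theorem norm_sub_le_of_transition_pow_ne_zero (k : ℕ) {i j : Fin n}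
    (hij : (transition h x ^ k) i j ≠ 0) : ‖x i - x j‖ ≤ k * h := by
  induction k generalizing j with
  | zero =>
    rw [pow_zero, Matrix.one_apply] at hij
    have : i = j := by by_contra hne; simp [hne] at hij
    simp [this]
  | succ k ih =>
    rw [pow_succ, Matrix.mul_apply] at hij
    obtain ⟨l, -, hl⟩ := Finset.exists_ne_zero_of_sum_ne_zero hij
    have h1 := ih (left_ne_zero_of_mul hl)
    have h2 := right_ne_zero_of_mul hl
    rw [transition_apply] at h2
    have h3 : affinity h x l j ≠ 0 := right_ne_zero_of_mul h2
    simp only [affinity, Matrix.of_apply, ne_eq, ite_eq_right_iff, not_forall] at h3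
    obtain ⟨⟨-, h4⟩, -⟩ := h3
    calc ‖x i - x j‖ ≤ ‖x i - x l‖ + ‖x l - x j‖ := norm_sub_le_norm_sub_add_norm_sub ..
      _ ≤ _ := by push_cast; linarith

end Graph

/-! ### Soft labels and the error decomposition -/

section Labels

/-- Coordinates lie in [0, 1], so (u - v)² ≤ u² + v² ≤ u + v, and the right side sums to 2. -/
theorem norm_sub_le_sqrt_two {C : ℕ} {u v : EuclideanSpace ℝ (Fin C)}
    (hu : ∀ c, 0 ≤ u c) (hv : ∀ c, 0 ≤ v c) (hu1 : ∑ c, u c = 1) (hv1 : ∑ c, v c = 1) :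
    ‖u - v‖ ≤ √2 := by
  rw [EuclideanSpace.norm_eq]
  refine Real.sqrt_le_sqrt ?_
  have h : ∀ w : EuclideanSpace ℝ (Fin C), (∀ c, 0 ≤ w c) → ∑ c, w c = 1 → ∀ c, w c ≤ 1 :=
    fun w hw hw1 c => hw1 ▸ Finset.single_le_sum (fun i _ => hw i) (Finset.mem_univ c)
  calc ∑ c, ‖(u - v) c‖ ^ 2 ≤ ∑ c, (u c + v c) := by
        refine Finset.sum_le_sum fun c _ => ?_
        rw [Real.norm_eq_abs, sq_abs, PiLp.sub_apply]
        nlinarith [hu c, hv c, h u hu hu1 c, h v hv hv1 c, mul_nonneg (hu c) (hv c)]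
    _ = 2 := by rw [Finset.sum_add_distrib, hu1, hv1]; norm_num

theorem softLabel_apply {d C : ℕ} (κ : Kernel (Feature d) (Fin C)) (x : Feature d) (c : Fin C) :
    softLabel κ x c = (κ x).real {c} := rfl

theorem softLabel_nonneg {d C : ℕ} (κ : Kernel (Feature d) (Fin C)) (x : Feature d) (c : Fin C) : 0 ≤ softLabel κ x c := by
  rw [softLabel_apply]; exact measureReal_nonneg

variable {d n C m : ℕ} (κ : Kernel (Feature d) (Fin C)) [IsMarkovKernel κ]

theorem sum_softLabel (x : Feature d) : ∑ c, softLabel κ x c = 1 := by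
  simp_rw [softLabel_apply]
  rw [sum_measureReal_singleton]
  simp

theorem softLabel_le_one (x : Feature d) (c : Fin C) : softLabel κ x c ≤ 1 := by
  rw [softLabel_apply]; exact measureReal_le_one

theorem estimate_nonneg_and_sum (hC : 1 ≤ C) {α h : ℝ} (hα0 : 0 ≤ α) (hα1 : α < 1)
    (x : Fin n → Feature d) (w : Fin m → Fin n × Fin C) (q : Fin n) :
    (∀ c, 0 ≤ estimate α h x w q c) ∧ ∑ c, estimate α h x w q c = 1 := by
  have hG : ∀ i j, 0 ≤ heatKernel α h x i j :=
    resolvent_nonneg transition_nonneg transition_row_sum_le hα0 hα1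
  have hC' : (C : ℝ) ≠ 0 := by positivity
  by_cases hT : totalScore α h x w q = 0
  · simp [estimate, hT, hC']
  · have hT0 : 0 ≤ totalScore α h x w q := Finset.sum_nonneg fun j _ => hG _ _
    simp only [estimate, hT, if_false]
    refine ⟨fun c => div_nonneg (Finset.sum_nonneg fun j _ => mul_nonneg (hG _ _) ?_) hT0, ?_⟩
    · split_ifs <;> simp
    · rw [← Finset.sum_div, Finset.sum_comm]
      simp_rw [← Finset.mul_sum]
      simp only [Finset.sum_ite_eq, Finset.mem_univ, if_true, mul_one]
      exact div_self hT

/-- The estimate is accurate once the total score and the centred scores are close to their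
conditional expectations. -/
theorem norm_estimate_sub_le {α h : ℝ} {x : Fin n → Feature d} {w : Fin m → Fin n × Fin C}
    {q : Fin n} {p b : EuclideanSpace ℝ (Fin C)} {ε η M : ℝ} (hε : 0 ≤ ε) (hM : 0 ≤ M)
    (hη0 : 0 ≤ η) (hη : η ≤ 1 / 4) (hηC : √C * η ≤ ε / 3) (hb : ‖b‖ ≤ 5 * ε / 12)
    (hT : (1 - η) * M < totalScore α h x w q)
    (hF : ∀ c, |∑ j, heatKernel α h x q (w j).1 * ((if (w j).2 = c then 1 else 0) - p c)
      - M * b c| ≤ η * M) :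
    ‖estimate α h x w q - p‖ ≤ ε := by
  have hT1 : 3 / 4 * M < totalScore α h x w q := by nlinarith
  set T := totalScore α h x w q with hTdef
  have hT0 : 0 < T := by nlinarith
  let F : EuclideanSpace ℝ (Fin C) := WithLp.toLp 2 fun c =>
    ∑ j, heatKernel α h x q (w j).1 * ((if (w j).2 = c then 1 else 0) - p c) - M * b c
  have hFn : ‖F‖ ≤ √C * (η * M) := by
    rw [EuclideanSpace.norm_eq]
    have hηM : 0 ≤ η * M := by positivity
    calc √(∑ c, ‖F c‖ ^ 2) ≤ √(∑ _c : Fin C, (η * M) ^ 2) := by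
          refine Real.sqrt_le_sqrt (Finset.sum_le_sum fun c _ => ?_)
          exact pow_le_pow_left₀ (norm_nonneg _) (hF c) 2
      _ = √C * (η * M) := by
          rw [Finset.sum_const, Finset.card_univ, Fintype.card_fin, nsmul_eq_mul,
            Real.sqrt_mul (Nat.cast_nonneg C), Real.sqrt_sq hηM]
  -- `M` plays the expected total score, `b` the normalised bias and `F` the fluctuation. The bounds
  -- add up to 5/12 + 1/3 = 3/4 of `M * ε`, which `T > 3M/4` absorbs.
  have key : estimate α h x w q - p = T⁻¹ • (M • b + F) := by
    ext c
    simp only [PiLp.sub_apply, PiLp.smul_apply, PiLp.add_apply, smul_eq_mul, estimate, F]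
    rw [if_neg hT0.ne']
    simp_rw [mul_sub, Finset.sum_sub_distrib, ← Finset.sum_mul]
    change _ / T - _ = T⁻¹ * (_ + (_ - T * _ - _))
    field_simp
    ring
  rw [key, norm_smul, Real.norm_of_nonneg (by positivity), inv_mul_le_iff₀ hT0]
  calc ‖M • b + F‖ ≤ M * (5 * ε / 12) + √C * (η * M) := by
        refine (norm_add_le _ _).trans (add_le_add ?_ hFn)
        rw [norm_smul, Real.norm_of_nonneg hM]
        exact mul_le_mul_of_nonneg_left hb hM
    _ ≤ T * ε := by nlinarith

end Labels

/-! ### A Bernstein inequality -/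

section Concentration

theorem exp_le_one_add_add_sq {u : ℝ} (hu : |u| ≤ 1) : Real.exp u ≤ 1 + u + u ^ 2 := by
  have := (abs_le.mp (Real.abs_exp_sub_one_sub_id_le hu)).2
  linarith

/-- A Bernstein type bound for sums of i.i.d. random variables on a finite space. -/
theorem measureReal_sum_ge_le {Ω : Type*} [Finite Ω] [MeasurableSpace Ω]
    [MeasurableSingletonClass Ω] (ν : Measure Ω) [IsProbabilityMeasure ν] (m : ℕ) {f : Ω → ℝ}
    {g τ η μ : ℝ} (hg : 0 < g) (hη0 : 0 ≤ η) (hη1 : η ≤ 1) (hf : ∀ ω, |f ω| ≤ g)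
    (hμ : ∫ ω, f ω ∂ν = μ) (hf2 : ∫ ω, f ω ^ 2 ∂ν ≤ g * τ) :
    (Measure.pi fun _ : Fin m => ν).real {w | m * (μ + η * τ) ≤ ∑ j, f (w j)} ≤
      Real.exp (-(m * τ * η ^ 2 / (4 * g))) := by
  -- This minimises the exponent -tητ + t²gτ, with value -τη²/(4g) per sample, and keeps `t * |f|`
  -- in the range of the quadratic bound on exp.
  set t := η / (2 * g) with ht
  have ht0 : 0 ≤ t := by positivity
  have hint : ∀ F : Ω → ℝ, Integrable F ν := fun F => .of_finite
  refine (measure_ge_le_exp_mul_mgf (m * (μ + η * τ)) ht0 .of_finite).trans ?_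
  have hmgf : mgf (fun w : Fin m → Ω => ∑ j, f (w j)) (Measure.pi fun _ : Fin m => ν) t
      = (∫ ω, Real.exp (t * f ω) ∂ν) ^ m := by
    simp only [mgf, Finset.mul_sum, Real.exp_sum]
    rw [integral_fintype_prod_eq_prod (fun _ ω => Real.exp (t * f ω)), Finset.prod_const,
      Finset.card_univ, Fintype.card_fin]
  have h1 : ∫ ω, Real.exp (t * f ω) ∂ν ≤ Real.exp (t * μ + t ^ 2 * (g * τ)) := by
    calc ∫ ω, Real.exp (t * f ω) ∂ν ≤ ∫ ω, (1 + t * f ω + t ^ 2 * f ω ^ 2) ∂ν := by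
          refine integral_mono (hint _) (hint _) fun ω => ?_
          refine (exp_le_one_add_add_sq ?_).trans_eq (by ring)
          rw [abs_mul, abs_of_nonneg ht0]
          calc t * |f ω| ≤ t * g := mul_le_mul_of_nonneg_left (hf ω) ht0
            _ = η / 2 := by rw [ht]; field_simp
            _ ≤ 1 := by linarith
      _ = 1 + t * μ + t ^ 2 * ∫ ω, f ω ^ 2 ∂ν := by
          rw [integral_add (hint _) (hint _), integral_add (hint _) (hint _),
            integral_const_mul, integral_const_mul, hμ]
          simp
      _ ≤ (t * μ + t ^ 2 * (g * τ)) + 1 := by nlinarith [sq_nonneg t]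
      _ ≤ _ := Real.add_one_le_exp _
  rw [hmgf]
  calc _ ≤ Real.exp (-t * (m * (μ + η * τ))) * Real.exp (t * μ + t ^ 2 * (g * τ)) ^ m := by
        gcongr
    _ = _ := by
        rw [← Real.exp_nat_mul, ← Real.exp_add]
        congr 1
        rw [ht]
        field_simp
        ring

end Concentration

/-! ### Accuracy conditional on the features -/

section Queries

variable {d n C m : ℕ} (κ : Kernel (Feature d) (Fin C)) [IsMarkovKernel κ]

theorem integral_queryLaw (x : Fin n → Feature d) (F : Fin n × Fin C → ℝ) :
    ∫ z, F z ∂(queryLaw κ x) = (n : ℝ)⁻¹ * ∑ i, ∑ c, softLabel κ (x i) c * F (i, c) := by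
  rw [integral_fintype .of_finite, Fintype.sum_prod_type, Finset.mul_sum]
  refine Finset.sum_congr rfl fun i _ => ?_
  rw [Finset.mul_sum]
  refine Finset.sum_congr rfl fun c _ => ?_
  rw [softLabel_apply, measureReal_def, queryLaw_singleton, uniformOn_univ]
  simp only [Measure.count_singleton, Fintype.card_fin, ENNReal.toReal_mul, ENNReal.toReal_div,
    ENNReal.toReal_one, ENNReal.toReal_natCast, measureReal_def, smul_eq_mul]
  ring

instance [NeZero n] (x : Fin n → Feature d) : IsProbabilityMeasure (queryLaw κ x) := by
  unfold queryLaw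
  infer_instance

/-- Given the features, all estimated soft labels are accurate with high probability. -/
theorem measure_failure_section_le [NeZero n] (hC : 1 ≤ C) {α h ε g : ℝ} (hε : 0 < ε)
    (hα0 : 0 ≤ α) (hα1 : α < 1) (hg : 0 < g) {x : Fin n → Feature d}
    (hdeg : ∀ i, 0 < degree h x i) (hG : ∀ i j, heatKernel α h x i j ≤ g)
    (hb : ∀ q, ‖∑ i, heatKernel α h x q i • (softLabel κ (x i) - softLabel κ (x q))‖
      ≤ (1 - α)⁻¹ * (5 * ε / 12)) {η : ℝ} (hη0 : 0 ≤ η) (hη : η ≤ 1 / 4)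
    (hηC : √C * η ≤ ε / 3) :
    (queriesKernel κ n m x) {w | ∃ q, ε < ‖estimate α h x w q - softLabel κ (x q)‖} ≤
      ENNReal.ofReal (3 * n * C *
        Real.exp (-(m * ((1 - α)⁻¹ / n) * η ^ 2 / (4 * g)))) := by
  have hn : (n : ℝ) ≠ 0 := Nat.cast_ne_zero.mpr (NeZero.ne n)
  have hα : 0 < 1 - α := by linarith
  set τ := (1 - α)⁻¹ / n with hτ
  set B := Real.exp (-(m * τ * η ^ 2 / (4 * g))) with hB
  have hB0 : 0 < B := Real.exp_pos _
  set P := Measure.pi fun _ : Fin m => queryLaw κ x with hP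
  have hS1 : ∀ i, ∑ j, transition h x i j = 1 := fun i => transition_row_sum_eq (hdeg i)
  have hG0 : ∀ i j, 0 ≤ heatKernel α h x i j :=
    resolvent_nonneg transition_nonneg transition_row_sum_le hα0 hα1
  have hGsum : ∀ q, ∑ i, heatKernel α h x q i = (1 - α)⁻¹ :=
    resolvent_row_sum transition_nonneg hS1 hα0 hα1
  have hmarg : ∀ u : Fin n → ℝ, ∫ z, u z.1 ∂(queryLaw κ x) = (n : ℝ)⁻¹ * ∑ i, u i := by
    intro u
    rw [integral_queryLaw]
    simp_rw [← Finset.sum_mul, sum_softLabel, one_mul]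
  -- One tail bound serves all statistics: if |f| is at most the score, then f² ≤ g · score, and the
  -- score has mean τ.
  have hdev : ∀ (q : Fin n) (f : Fin n × Fin C → ℝ) (μ : ℝ),
      (∀ z, |f z| ≤ heatKernel α h x q z.1) → ∫ z, f z ∂(queryLaw κ x) = μ →
      P.real {w | m * (μ + η * τ) ≤ ∑ j, f (w j)} ≤ B := by
    intro q f μ hf hμ
    refine measureReal_sum_ge_le _ m hg hη0 (by linarith) (fun z => (hf z).trans (hG _ _)) hμ ?_
    calc ∫ z, f z ^ 2 ∂(queryLaw κ x) ≤ ∫ z, g * heatKernel α h x q z.1 ∂(queryLaw κ x) := by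
          refine integral_mono .of_finite .of_finite fun z => ?_
          have := hf z
          have h2 := hG q z.1
          have h3 := abs_nonneg (f z)
          change f z ^ 2 ≤ _
          rw [← sq_abs]
          nlinarith
      _ = g * τ := by
          rw [integral_const_mul, hmarg, hGsum, hτ]
          ring
  let b : Fin n → EuclideanSpace ℝ (Fin C) := fun q =>
    (1 - α) • ∑ i, heatKernel α h x q i • (softLabel κ (x i) - softLabel κ (x q))
  let f : Fin n → Fin C → Fin n × Fin C → ℝ := fun q c z =>
    heatKernel α h x q z.1 * ((if z.2 = c then 1 else 0) - softLabel κ (x q) c)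
  have hfabs : ∀ q c z, |f q c z| ≤ heatKernel α h x q z.1 := by
    intro q c z
    simp only [f]
    rw [abs_mul, abs_of_nonneg (hG0 _ _)]
    refine mul_le_of_le_one_right (hG0 _ _) (abs_le.mpr ?_)
    have h1 := softLabel_nonneg κ (x q) c
    have h2 := softLabel_le_one κ (x q) c
    split_ifs <;> constructor <;> linarith
  have hfint : ∀ q c, ∫ z, f q c z ∂(queryLaw κ x) = τ * b q c := by
    intro q c
    have h1 : b q c = (1 - α) * ∑ i, heatKernel α h x q i *
        (softLabel κ (x i) c - softLabel κ (x q) c) := by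
      simp [b]
    rw [integral_queryLaw, h1, hτ]
    have h2 : ∀ i, ∑ c', softLabel κ (x i) c' * f q c (i, c')
        = heatKernel α h x q i * (softLabel κ (x i) c - softLabel κ (x q) c) := by
      intro i
      simp only [f, mul_sub, Finset.sum_sub_distrib, mul_ite, mul_one, mul_zero]
      simp only [Finset.sum_ite_eq', Finset.mem_univ, if_true]
      rw [← Finset.sum_mul, sum_softLabel]
      ring
    simp_rw [h2]
    field_simp
  have hone : ∀ q, P.real {w | ε < ‖estimate α h x w q - softLabel κ (x q)‖} ≤ 3 * C * B := by
    intro q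
    -- The bad events are a low total score and, for each class, a centred score that is too high or
    -- too low: 1 + 2C ≤ 3C tails per point.
    let A0 : Set (Fin m → Fin n × Fin C) :=
      {w | m * (-τ + η * τ) ≤ ∑ j, -heatKernel α h x q (w j).1}
    let A1 : Fin C → Set (Fin m → Fin n × Fin C) := fun c =>
      {w | m * (τ * b q c + η * τ) ≤ ∑ j, f q c (w j)}
    let A2 : Fin C → Set (Fin m → Fin n × Fin C) := fun c =>
      {w | m * (-(τ * b q c) + η * τ) ≤ ∑ j, -f q c (w j)}
    have hA0 : P.real A0 ≤ B := by
      refine hdev q (fun z => -heatKernel α h x q z.1) (-τ) (fun z => ?_) ?_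
      · rw [abs_neg, abs_of_nonneg (hG0 _ _)]
      · rw [integral_neg, hmarg, hGsum, hτ]
        ring
    have hA1 : ∀ c, P.real (A1 c) ≤ B := fun c => hdev q (f q c) _ (hfabs q c) (hfint q c)
    have hA2 : ∀ c, P.real (A2 c) ≤ B := fun c => by
      refine hdev q (fun z => -f q c z) _ (fun z => ?_) ?_
      · rw [abs_neg]; exact hfabs q c z
      · rw [integral_neg, hfint]
    have hsub : {w | ε < ‖estimate α h x w q - softLabel κ (x q)‖} ⊆
        A0 ∪ ⋃ c, (A1 c ∪ A2 c) := by
      intro w hw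
      by_contra hnot
      simp only [Set.mem_union, Set.mem_iUnion, not_or, not_exists, A0, A1, A2,
        Set.mem_ofPred_eq, not_le, Finset.sum_neg_distrib] at hnot
      obtain ⟨h0, h12⟩ := hnot
      rw [Set.mem_ofPred_eq] at hw
      refine absurd hw (not_lt.mpr ?_)
      refine norm_estimate_sub_le (b := b q) (M := m * τ) hε.le ?_ hη0 hη hηC ?_ ?_ fun c => ?_
      · positivity
      · simp only [b]
        rw [norm_smul, Real.norm_of_nonneg hα.le]
        calc _ ≤ (1 - α) * ((1 - α)⁻¹ * (5 * ε / 12)) :=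
              mul_le_mul_of_nonneg_left (hb q) hα.le
          _ = _ := by rw [← mul_assoc, mul_inv_cancel₀ hα.ne', one_mul]
      · rw [totalScore]
        linarith
      · have h1 := (h12 c).1
        have h2 := (h12 c).2
        rw [abs_le]
        constructor <;> linarith
    calc _ ≤ P.real (A0 ∪ ⋃ c, (A1 c ∪ A2 c)) := measureReal_mono hsub
      _ ≤ P.real A0 + ∑ c, (P.real (A1 c) + P.real (A2 c)) := by
          refine (measureReal_union_le _ _).trans (add_le_add le_rfl ?_)
          refine (measureReal_iUnion_fintype_le _).trans (Finset.sum_le_sum fun c _ => ?_)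
          exact measureReal_union_le _ _
      _ ≤ B + ∑ _c : Fin C, (B + B) :=
          add_le_add hA0 (Finset.sum_le_sum fun c _ => add_le_add (hA1 c) (hA2 c))
      _ ≤ 3 * C * B := by
          rw [Finset.sum_const, Finset.card_univ, Fintype.card_fin, nsmul_eq_mul]
          have : (1 : ℝ) ≤ C := by exact_mod_cast hC
          nlinarith
  change P _ ≤ _
  rw [← ofReal_measureReal]
  refine ENNReal.ofReal_le_ofReal ?_
  rw [Set.ofPred_exists]
  calc _ ≤ ∑ q, P.real {w | ε < ‖estimate α h x w q - softLabel κ (x q)‖} :=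
        measureReal_iUnion_fintype_le _
    _ ≤ ∑ _q : Fin n, 3 * C * B := Finset.sum_le_sum fun q _ => hone q
    _ = 3 * n * C * B := by
        rw [Finset.sum_const, Finset.card_univ, Fintype.card_fin, nsmul_eq_mul]
        ring

end Queries

/-! ### Lower tails of the degrees -/

section Degree

/-- Only the part of the ball inside `𝒳` is counted: it fills a fraction `ρ` of the volume and
carries density at least `pmin`. -/
theorem featureLaw_real_ball_ge {d C : ℕ} {𝒳 : Set (Feature d)} {p : Feature d → ℝ}
    {κ : Kernel (Feature d) (Fin C)} {pmin pmax ρ r₀ L : ℝ}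
    (hA : Assumptions 𝒳 p κ pmin pmax ρ r₀ L) (hpmin : 0 < pmin) (hρ : 0 < ρ)
    {h : ℝ} (h0 : 0 < h) (hr : h < r₀) {z : Feature d} (hz : z ∈ 𝒳) :
    pmin * ρ * (volume : Measure (Feature d)).real (Metric.ball 0 1) * h ^ d ≤
      (featureLaw p).real (Metric.ball z h) := by
  have := hA.isProbabilityMeasure
  have hm : MeasurableSet (Metric.ball z h ∩ 𝒳) :=
    measurableSet_ball.inter hA.validRegion.measurableSet
  have h1 : ENNReal.ofReal pmin * (ENNReal.ofReal ρ * volume (Metric.ball z h)) ≤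
      featureLaw p (Metric.ball z h) := by
    calc _ ≤ ENNReal.ofReal pmin * volume (Metric.ball z h ∩ 𝒳) := by
          gcongr
          exact hA.validRegion.ball_fraction h h0 hr z hz
      _ = ∫⁻ _ in Metric.ball z h ∩ 𝒳, ENNReal.ofReal pmin := by
          rw [setLIntegral_const]
      _ ≤ ∫⁻ x in Metric.ball z h ∩ 𝒳, ENNReal.ofReal (p x) :=
          setLIntegral_mono' hm fun x hx =>
            ENNReal.ofReal_le_ofReal (hA.validRegion.density_bounds x hx.2).1
      _ = featureLaw p (Metric.ball z h ∩ 𝒳) := by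
          rw [featureLaw, withDensity_apply _ hm]
      _ ≤ _ := measure_mono Set.inter_subset_left
  have h2 := ENNReal.toReal_mono (measure_ne_top _ _) h1
  rw [Measure.addHaar_ball_of_pos _ _ h0] at h2
  simp only [ENNReal.toReal_mul, ENNReal.toReal_ofReal hpmin.le, ENNReal.toReal_ofReal hρ.le,
    ENNReal.toReal_ofReal (pow_nonneg h0.le _), finrank_euclideanSpace, Fintype.card_fin] at h2
  rw [measureReal_def, measureReal_def]
  linarith

/-- A Bernoulli Laplace transform, bounded through 1 - u ≤ exp(-u). -/
theorem integral_exp_neg_indicator_ball_le {d : ℕ} (P : Measure (Feature d))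
    [IsProbabilityMeasure P] {h μ : ℝ} {z : Feature d} (hz : μ ≤ P.real (Metric.ball z h)) :
    ∫ y, Real.exp (-if ‖z - y‖ < h then 1 else 0) ∂P ≤
      Real.exp (-((1 - Real.exp (-1)) * μ)) := by
  have h1 : ∀ y, Real.exp (-if ‖z - y‖ < h then 1 else 0) =
      1 - (Metric.ball z h).indicator (fun _ => 1 - Real.exp (-1)) y := by
    intro y
    have : y ∈ Metric.ball z h ↔ ‖z - y‖ < h := by
      rw [Metric.mem_ball, dist_comm, dist_eq_norm]
    by_cases hy : ‖z - y‖ < h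
    · rw [Set.indicator_of_mem (this.mpr hy), if_pos hy]; ring
    · rw [Set.indicator_of_notMem (fun hc => hy (this.mp hc)), if_neg hy]; simp
  simp_rw [h1]
  rw [integral_sub (integrable_const _) ((integrable_const _).indicator measurableSet_ball),
    integral_indicator_const _ measurableSet_ball]
  have he : Real.exp (-1) ≤ 1 := Real.exp_le_one_iff.mpr (by norm_num)
  have h3 := Real.add_one_le_exp (-((1 - Real.exp (-1)) * μ))
  simp only [integral_const, probReal_univ, smul_eq_mul, one_mul]
  nlinarith [mul_le_mul_of_nonneg_left hz (sub_nonneg.mpr he)]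

theorem measurable_degree {d n : ℕ} (h : ℝ) (i : Fin n) :
    Measurable fun x : Fin n → Feature d => degree h x i := by
  unfold degree affinity
  refine Finset.measurable_sum _ fun j _ => ?_
  simp only [Matrix.of_apply]
  by_cases hij : i = j
  · simp [hij]
  · simp only [ne_eq, hij, not_false_eq_true, true_and]
    exact Measurable.ite (measurableSet_lt
      ((measurable_pi_apply i).sub (measurable_pi_apply j)).norm measurable_const)
      measurable_const measurable_const

/-- Lower tail of the degrees of the ball graph on i.i.d. points. -/
theorem measureReal_degree_le {d n : ℕ} (P : Measure (Feature d)) [IsProbabilityMeasure P]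
    {h μ : ℝ} (hμ : ∀ᵐ z ∂P, μ ≤ P.real (Metric.ball z h)) (hμ0 : 0 ≤ μ) (i : Fin (n + 1)) :
    (Measure.pi fun _ : Fin (n + 1) => P).real {x | degree h x i ≤ n * μ / 2} ≤
      Real.exp (-(n * μ / 10)) := by
  have hm : Measurable fun x : Fin (n + 1) → Feature d => Real.exp (-1 * degree h x i) :=
    ((measurable_degree h i).const_mul _).exp
  have hint : Integrable (fun x : Fin (n + 1) → Feature d => Real.exp (-1 * degree h x i))
      (Measure.pi fun _ => P) := by
    refine Integrable.of_bound hm.aestronglyMeasurable 1 (ae_of_all _ fun x => ?_)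
    rw [Real.norm_of_nonneg (Real.exp_pos _).le, Real.exp_le_one_iff]
    linarith [degree_nonneg (h := h) (x := x) i]
  refine (measure_le_le_exp_mul_mgf (n * μ / 2) (by norm_num : (-1 : ℝ) ≤ 0) hint).trans ?_
  let φ : Feature d → Feature d → ℝ := fun z y => Real.exp (-if ‖z - y‖ < h then 1 else 0)
  have hmgf : mgf (fun x : Fin (n + 1) → Feature d => degree h x i)
      (Measure.pi fun _ => P) (-1) ≤ Real.exp (-((1 - Real.exp (-1)) * μ)) ^ n := by
    -- Once `x i` is split off and frozen, the degree is a sum of `n` independent indicators, so the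
    -- Laplace transform factors.
    let g : Feature d × (Fin n → Feature d) → ℝ := fun z => ∏ j, φ z.1 (z.2 j)
    have hmp := measurePreserving_piFinSuccAbove (fun _ : Fin (n + 1) => P) i
    have hg : ∀ x : Fin (n + 1) → Feature d, Real.exp (-1 * degree h x i) =
        g (MeasurableEquiv.piFinSuccAbove (fun _ => Feature d) i x) := by
      intro x
      simp only [g, φ, degree, affinity, Matrix.of_apply]
      rw [← Real.exp_sum, Fin.sum_univ_succAbove _ i, Finset.sum_neg_distrib, neg_one_mul]
      simp [Fin.removeNth, (Fin.succAbove_ne i _).symm]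
    have hgint : Integrable g (P.prod (Measure.pi fun _ : Fin n => P)) := by
      rw [← hmp.integrable_comp_emb (MeasurableEquiv.measurableEmbedding _)]
      exact hint.congr (ae_of_all _ hg)
    rw [mgf, integral_congr_ae (ae_of_all _ hg), hmp.integral_comp', integral_prod _ hgint]
    have h1 : ∀ᵐ z ∂P, ∫ y, g (z, y) ∂(Measure.pi fun _ : Fin n => P) ≤
        Real.exp (-((1 - Real.exp (-1)) * μ)) ^ n := by
      filter_upwards [hμ] with z hz
      simp only [g]
      rw [integral_fintype_prod_eq_prod (fun _ y => φ z y), Finset.prod_const,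
        Finset.card_univ, Fintype.card_fin]
      exact pow_le_pow_left₀ (integral_nonneg fun _ => (Real.exp_pos _).le)
        (integral_exp_neg_indicator_ball_le P hz) n
    calc _ ≤ ∫ _, Real.exp (-((1 - Real.exp (-1)) * μ)) ^ n ∂P :=
          integral_mono_ae hgint.integral_prod_left (integrable_const _) h1
      _ = _ := by simp
  calc _ ≤ Real.exp (- -1 * (n * μ / 2)) * Real.exp (-((1 - Real.exp (-1)) * μ)) ^ n := by
        gcongr
    _ ≤ _ := by
        rw [← Real.exp_nat_mul, ← Real.exp_add, Real.exp_le_exp]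
        -- This gives 1/2 - (1 - e⁻¹) ≤ 1/2 - 3/5 = -1/10, the constant in the exponent.
        have he : Real.exp (-1) ≤ 2 / 5 := by
          rw [Real.exp_neg, inv_le_comm₀ (Real.exp_pos _) (by norm_num)]
          linarith [Real.exp_one_gt_d9]
        nlinarith [mul_nonneg (Nat.cast_nonneg (α := ℝ) n) hμ0]

end Degree

/-! ### Measurability of the failure event -/

section Measurability

/-- The kernel depends on the features only through the finite adjacency pattern, and every function
of that pattern is measurable; the matrix inverse needs no separate treatment. -/
theorem measurable_heatKernel_apply {d n : ℕ} (α h : ℝ) (i j : Fin n) :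
    Measurable fun x : Fin n → Feature d => heatKernel α h x i j := by
  let e : (Fin n → Feature d) → Fin n → Fin n → Bool := fun x i j => decide (‖x i - x j‖ < h)
  have he : Measurable e := by
    refine measurable_pi_iff.mpr fun i => measurable_pi_iff.mpr fun j => ?_
    refine measurable_to_bool ?_
    have : (fun x : Fin n → Feature d => decide (‖x i - x j‖ < h)) ⁻¹' {true}
        = {x | ‖x i - x j‖ < h} := by
      ext x; simp
    rw [this]
    exact measurableSet_lt ((measurable_pi_apply i).sub (measurable_pi_apply j)).norm
      measurable_const
  let A : (Fin n → Fin n → Bool) → Matrix (Fin n) (Fin n) ℝ := fun a =>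
    Matrix.of fun i j => if i ≠ j ∧ a i j = true then 1 else 0
  let F : (Fin n → Fin n → Bool) → ℝ := fun a =>
    (1 - α • (Matrix.diagonal (fun i => (∑ j, A a i j)⁻¹) * A a))⁻¹ i j
  have hF : (fun x : Fin n → Feature d => heatKernel α h x i j) = F ∘ e := by
    funext x
    have hA : A (e x) = affinity h x := by
      ext i j
      simp [A, e, affinity]
    simp only [Function.comp, F, hA, heatKernel, transition]
    rfl
  rw [hF]
  exact (measurable_of_countable F).comp he

theorem measurableSet_failure {d C : ℕ} (κ : Kernel (Feature d) (Fin C)) (ε L : ℝ) (n m : ℕ) :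
    MeasurableSet (failure κ ε L n m) := by
  have h : ∀ w : Fin m → Fin n × Fin C,
      MeasurableSet {x : Fin n → Feature d | (x, w) ∈ failure κ ε L n m} := by
    intro w
    simp only [failure, Set.mem_ofPred_eq]
    rw [Set.ofPred_exists]
    refine MeasurableSet.iUnion fun q => measurableSet_lt measurable_const (Measurable.norm ?_)
    refine Measurable.sub ?_ ?_
    · refine (PiLp.continuous_toLp 2 _).measurable.comp (measurable_pi_iff.mpr fun c => ?_)
      have hT : Measurable fun x : Fin n → Feature d =>
          totalScore (spreadingIntensity d n) (bandwidth d ε L n) x w q :=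
        Finset.measurable_sum _ fun j _ => measurable_heatKernel_apply ..
      refine Measurable.ite (hT (measurableSet_singleton 0)) measurable_const
        (Measurable.div (Finset.measurable_sum _ fun j _ => ?_) hT)
      exact (measurable_heatKernel_apply ..).mul_const _
    · refine (PiLp.continuous_toLp 2 _).measurable.comp (measurable_pi_iff.mpr fun c => ?_)
      exact ((κ.measurable_coe (measurableSet_singleton c)).comp
        (measurable_pi_apply q)).ennreal_toReal
  have hU : failure κ ε L n m =
      ⋃ w : Fin m → Fin n × Fin C, {x | (x, w) ∈ failure κ ε L n m} ×ˢ {w} := by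
    ext ⟨x, w⟩
    simp
  rw [hU]
  exact MeasurableSet.iUnion fun w => (h w).prod (measurableSet_singleton w)

end Measurability

/-! ### Asymptotics of intensity and bandwidth -/

section Parameters

/-- The diffusion time `(1 - α_n)⁻¹ = n^{1/(d+1)}`. -/
noncomputable def diffusionTime (d n : ℕ) : ℝ := (n : ℝ) ^ (1 / ((d : ℝ) + 1))

theorem one_le_diffusionTime (d : ℕ) {n : ℕ} (hn : 1 ≤ n) : 1 ≤ diffusionTime d n :=
  Real.one_le_rpow (by exact_mod_cast hn) (by positivity)

theorem one_lt_diffusionTime (d : ℕ) {n : ℕ} (hn : 2 ≤ n) : 1 < diffusionTime d n :=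
  Real.one_lt_rpow (by exact_mod_cast hn) (by positivity)

theorem diffusionTime_pow (d n : ℕ) : diffusionTime d n ^ (d + 1) = n := by
  rw [diffusionTime, ← Real.rpow_natCast, ← Real.rpow_mul (Nat.cast_nonneg n)]
  push_cast
  rw [one_div_mul_cancel (by positivity), Real.rpow_one]

theorem tendsto_diffusionTime (d : ℕ) : Tendsto (diffusionTime d) atTop atTop :=
  (tendsto_rpow_atTop (by positivity)).comp tendsto_natCast_atTop_atTop

theorem spreadingIntensity_eq (d n : ℕ) :
    spreadingIntensity d n = 1 - (diffusionTime d n)⁻¹ := by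
  rw [spreadingIntensity, Real.rpow_neg (Nat.cast_nonneg n), diffusionTime]

theorem spreadingIntensity_nonneg (d : ℕ) {n : ℕ} (hn : 1 ≤ n) :
    0 ≤ spreadingIntensity d n := by
  rw [spreadingIntensity_eq]
  linarith [inv_le_one_of_one_le₀ (one_le_diffusionTime d hn)]

theorem spreadingIntensity_lt_one (d : ℕ) {n : ℕ} (hn : 1 ≤ n) :
    spreadingIntensity d n < 1 := by
  rw [spreadingIntensity_eq]
  have : 0 < (diffusionTime d n)⁻¹ := inv_pos.mpr (by linarith [one_le_diffusionTime d hn])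
  linarith

theorem spreadingIntensity_pos (d : ℕ) {n : ℕ} (hn : 2 ≤ n) : 0 < spreadingIntensity d n := by
  rw [spreadingIntensity_eq]
  linarith [inv_lt_one_of_one_lt₀ (one_lt_diffusionTime d hn)]

theorem inv_one_sub_spreadingIntensity (d n : ℕ) :
    (1 - spreadingIntensity d n)⁻¹ = diffusionTime d n := by
  rw [spreadingIntensity_eq, sub_sub_cancel, inv_inv]

theorem tendsto_spreadingIntensity (d : ℕ) :
    Tendsto (fun n : ℕ => spreadingIntensity d n) atTop (𝓝 1) := by
  simp_rw [spreadingIntensity_eq]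
  simpa using (tendsto_diffusionTime d).inv_tendsto_atTop.const_sub (1 : ℝ)

theorem tendsto_bandwidth (d : ℕ) (ε L : ℝ) (hε : 0 < ε) :
    Tendsto (fun n : ℕ => bandwidth d ε L n) atTop (𝓝 0) := by
  set c := ε / (12 * √2) with hc
  have hc0 : 0 < c := by positivity
  have hb : ∀ n, bandwidth d ε L n =
      ε / (3 * L) * (⌈Real.logb (spreadingIntensity d n) c⌉ : ℝ)⁻¹ := fun n => by
    rw [bandwidth, div_mul_eq_div_div, div_eq_mul_inv]
  simp_rw [hb]
  -- For `c = 1` the logarithm is 0 and the bandwidth is 0 by the convention for division. For `c >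
  -- 1` the logarithm tends to -∞, hence the absolute values below.
  by_cases hc1 : c = 1
  · simp [hc1]
  have hlogc : Real.log c ≠ 0 := Real.log_ne_zero_of_pos_of_ne_one hc0 hc1
  have hlog : Tendsto (fun n : ℕ => |Real.log (spreadingIntensity d n)|) atTop (𝓝[>] 0) := by
    rw [tendsto_nhdsWithin_iff]
    constructor
    · have h := ((Real.continuousAt_log one_ne_zero).tendsto.comp (tendsto_spreadingIntensity d)).abs
      simpa using h
    · filter_upwards [eventually_ge_atTop 2] with n hn
      exact abs_pos.mpr (Real.log_ne_zero_of_pos_of_ne_one (spreadingIntensity_pos d hn)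
        (spreadingIntensity_lt_one d (by omega)).ne)
  have hlogb : Tendsto (fun n : ℕ => |Real.logb (spreadingIntensity d n) c|) atTop atTop := by
    simp_rw [Real.logb, abs_div, div_eq_mul_inv]
    exact Tendsto.const_mul_atTop (abs_pos.mpr hlogc) (tendsto_inv_nhdsGT_zero.comp hlog)
  have hceil : Tendsto (fun n : ℕ => |(⌈Real.logb (spreadingIntensity d n) c⌉ : ℝ)|)
      atTop atTop := by
    refine tendsto_atTop_mono (fun n => ?_) (tendsto_atTop_add_const_right _ (-1) hlogb)
    set y := Real.logb (spreadingIntensity d n) c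
    have h1 := Int.le_ceil y
    have h2 := Int.ceil_lt_add_one y
    have h3 : |y| ≤ |(⌈y⌉ : ℝ)| + |y - ⌈y⌉| := by
      have := abs_add_le (⌈y⌉ : ℝ) (y - ⌈y⌉)
      simpa using this
    have h4 : |y - ⌈y⌉| ≤ 1 := abs_le.mpr ⟨by linarith, by linarith⟩
    linarith
  have hinv : Tendsto (fun n : ℕ => (⌈Real.logb (spreadingIntensity d n) c⌉ : ℝ)⁻¹)
      atTop (𝓝 0) := by
    rw [tendsto_zero_iff_abs_tendsto_zero]
    exact hceil.inv_tendsto_atTop.congr fun n => (abs_inv _).symm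
  simpa using hinv.const_mul (ε / (3 * L))

/-- The number of diffusion steps taken into account: `⌈log_{α_n} c⌉` is a positive integer of
order at most `(1 - α_n)⁻¹`, and `α_n` to this power is at most `c`. -/
theorem exists_natCast_eq_ceil_logb (d : ℕ) {n : ℕ} (hn : 2 ≤ n) {c : ℝ} (hc0 : 0 < c)
    (hc1 : c < 1) : ∃ K : ℕ, (⌈Real.logb (spreadingIntensity d n) c⌉ : ℝ) = K ∧ 0 < K ∧
      spreadingIntensity d n ^ K ≤ c ∧ (K : ℝ) ≤ (1 - Real.log c) * diffusionTime d n := by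
  set α := spreadingIntensity d n with hα
  have hα0 : 0 < α := spreadingIntensity_pos d hn
  have hα1 : α < 1 := spreadingIntensity_lt_one d (by omega)
  have hy : 0 < Real.logb α c := Real.logb_pos_of_base_lt_one hα0 hα1 hc0 hc1
  have hK : 0 < ⌈Real.logb α c⌉ := Int.ceil_pos.mpr hy
  obtain ⟨K, hKe⟩ := Int.eq_ofNat_of_zero_le hK.le
  refine ⟨K, by rw [hKe]; simp, by omega, ?_, ?_⟩
  · have h1 : Real.logb α c ≤ K := by
      have := Int.le_ceil (Real.logb α c)
      rw [hKe] at this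
      exact_mod_cast this
    calc α ^ K = α ^ (K : ℝ) := (Real.rpow_natCast _ _).symm
      _ ≤ α ^ Real.logb α c := Real.rpow_le_rpow_of_exponent_ge hα0 hα1.le h1
      _ = c := Real.rpow_logb hα0 hα1.ne hc0
  · have h1 : (K : ℝ) < Real.logb α c + 1 := by
      have := Int.ceil_lt_add_one (Real.logb α c)
      rw [hKe] at this
      exact_mod_cast this
    have ht := one_lt_diffusionTime d hn
    have hlogα : Real.log α ≤ -(diffusionTime d n)⁻¹ := by
      have := Real.log_le_sub_one_of_pos hα0
      rw [hα, spreadingIntensity_eq] at this ⊢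
      linarith
    have hlogc : Real.log c < 0 := Real.log_neg hc0 hc1
    have h2 : Real.logb α c ≤ -Real.log c * diffusionTime d n := by
      have htp : 0 < (diffusionTime d n)⁻¹ := inv_pos.mpr (by linarith)
      rw [Real.logb, ← neg_div_neg_eq, div_le_iff₀ (by linarith)]
      calc -Real.log c = -Real.log c * diffusionTime d n * (diffusionTime d n)⁻¹ := by
            field_simp
        _ ≤ _ := by
            refine mul_le_mul_of_nonneg_left (by linarith) (mul_nonneg ?_ ?_) <;> linarith
    -- Rounding up adds less than 1, which is below the diffusion time and is absorbed by the 1 in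
    -- `1 - Real.log c`.
    nlinarith

end Parameters

/-! ### The failure probability at general budget -/

section Failure

variable {d C : ℕ}

theorem failure_eq_empty (κ : Kernel (Feature d) (Fin C)) [IsMarkovKernel κ] (hC : 1 ≤ C)
    {ε : ℝ} (hε : √2 ≤ ε) (L : ℝ) (n m : ℕ) : failure κ ε L n m = ∅ := by
  rw [Set.eq_empty_iff_forall_notMem]
  rintro ⟨x, w⟩ hxw
  simp only [failure, Set.mem_ofPred_eq] at hxw
  obtain ⟨q, hq⟩ := hxw
  have hn : 1 ≤ n := by have := q.2; omega
  obtain ⟨h0, h1⟩ := estimate_nonneg_and_sum (h := bandwidth d ε L n) hC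
    (spreadingIntensity_nonneg d hn) (spreadingIntensity_lt_one d hn) x w q
  exact absurd hq (not_lt.mpr
    ((norm_sub_le_sqrt_two h0 (softLabel_nonneg κ _) h1 (sum_softLabel κ _)).trans hε))

/-- Integrating out the queries, which are accurate for all features in a good event. -/
theorem sampleLaw_le_add (PX : Measure (Feature d)) [IsProbabilityMeasure PX]
    (κ : Kernel (Feature d) (Fin C)) [IsMarkovKernel κ] {n m : ℕ} [NeZero n]
    {s : Set ((Fin n → Feature d) × (Fin m → Fin n × Fin C))} (hs : MeasurableSet s)
    {D : Set (Fin n → Feature d)} (hD : MeasurableSet D) {e : ℝ≥0∞}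
    (h : ∀ᵐ x ∂(Measure.pi fun _ : Fin n => PX), x ∉ D →
      queriesKernel κ n m x {w | (x, w) ∈ s} ≤ e) :
    sampleLaw PX κ n m s ≤ (Measure.pi fun _ : Fin n => PX) D + e := by
  have hK : ∀ x, queriesKernel κ n m x = Measure.pi fun _ => queryLaw κ x := fun _ => rfl
  have hprob : IsMarkovKernel (queriesKernel κ n m) :=
    ⟨fun x => by rw [hK]; infer_instance⟩
  rw [sampleLaw, Measure.compProd_apply hs]
  calc _ ≤ ∫⁻ x, (D.indicator 1 x + e) ∂(Measure.pi fun _ : Fin n => PX) := by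
        refine lintegral_mono_ae ?_
        filter_upwards [h] with x hx
        by_cases hxD : x ∈ D
        · rw [Set.indicator_of_mem hxD]
          exact prob_le_one.trans le_self_add
        · exact (hx hxD).trans le_add_self
    _ = _ := by
        rw [lintegral_add_right _ measurable_const, lintegral_indicator_one hD]
        simp

/-- The first term pays for a vertex of low degree, the second for unlucky queries on a good graph.
Keeping them separate, for every `m`, lets both budget regimes be read off. -/
theorem exists_failure_bound (hC : 1 ≤ C) {ε L pmin pmax ρ r₀ : ℝ}
    (hε : 0 < ε) (hL : 0 < L) (hpmin : 0 < pmin) (hρ : 0 < ρ) (hr₀ : 0 < r₀) :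
    ∃ a : ℝ, 0 < a ∧ ∃ N : ℕ, 1 ≤ N ∧ ∀ n : ℕ, N ≤ n → ∀ m : ℕ,
      ∀ (𝒳 : Set (Feature d)) (p : Feature d → ℝ)
        (κ : Kernel (Feature d) (Fin C)) [IsMarkovKernel κ],
        Assumptions 𝒳 p κ pmin pmax ρ r₀ L →
        sampleLaw (featureLaw p) κ n m (failure κ ε L n m) ≤
          ENNReal.ofReal (n * Real.exp (-a * diffusionTime d n) +
            3 * n * C * Real.exp (-a * (m * diffusionTime d n / n))) := by
  -- For large `ε` the logarithm defining the bandwidth is not positive, but two probability vectors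
  -- are never more than √2 apart.
  rcases le_or_gt (12 * √2) ε with hbig | hsmall
  · refine ⟨1, one_pos, 1, le_rfl, fun n _ m 𝒳 p κ _ _ => ?_⟩
    rw [failure_eq_empty κ hC (by linarith [Real.sqrt_nonneg 2])]
    simp
  set c := ε / (12 * √2) with hc
  have hc0 : 0 < c := by positivity
  have hc1 : c < 1 := (div_lt_one (by positivity)).mpr hsmall
  have hlogc : Real.log c < 0 := Real.log_neg hc0 hc1
  set A := 1 - Real.log c with hA
  have hA0 : 0 < A := by linarith
  set ω := (volume : Measure (Feature d)).real (Metric.ball 0 1) with hω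
  have hω0 : 0 < ω := ENNReal.toReal_pos (Metric.measure_ball_pos _ _ one_pos).ne'
    measure_ball_lt_top.ne
  -- From K ≤ A t one gets h ≥ ε/(3LA)/t, hence μ t^d ≥ `b`. Degrees will be at least bt/4, so
  -- kernel entries are at most 1 + t/(bt/4) = `g`.
  set b := pmin * ρ * ω * (ε / (3 * L * A)) ^ d with hb
  have hb0 : 0 < b := by positivity
  set g := 1 + 4 / b with hg
  have hg0 : 0 < g := by positivity
  have hC0 : (0 : ℝ) < C := by exact_mod_cast hC
  set η := min (1 / 4) (ε / (3 * √C)) with hη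
  have hη0 : 0 < η := lt_min (by norm_num) (by positivity)
  have hηC : √C * η ≤ ε / 3 := by
    calc √C * η ≤ √C * (ε / (3 * √C)) :=
          mul_le_mul_of_nonneg_left (min_le_right _ _) (Real.sqrt_nonneg _)
      _ = ε / 3 := by field_simp
  obtain ⟨N₀, hN₀⟩ := eventually_atTop.mp
    ((tendsto_bandwidth d ε L hε).eventually (gt_mem_nhds hr₀))
  -- The rates are those of the degree tail, kμ/10 ≥ (b/20) t, and of the Bernstein bound.
  refine ⟨min (b / 20) (η ^ 2 / (4 * g)), by positivity, max N₀ 2, by omega, ?_⟩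
  intro n hn m 𝒳 p κ _ hass
  have hn2 : 2 ≤ n := (le_max_right _ _).trans hn
  have hhr : bandwidth d ε L n < r₀ := hN₀ n ((le_max_left _ _).trans hn)
  set t := diffusionTime d n with ht
  have ht1 : 1 < t := one_lt_diffusionTime d hn2
  set α := spreadingIntensity d n with hα
  have hα0 : 0 ≤ α := spreadingIntensity_nonneg d (by omega)
  have hα1 : α < 1 := spreadingIntensity_lt_one d (by omega)
  have hαt : (1 - α)⁻¹ = t := inv_one_sub_spreadingIntensity d n
  obtain ⟨K, hKe, hK0, hKα, hKt⟩ := exists_natCast_eq_ceil_logb d hn2 hc0 hc1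
  set h := bandwidth d ε L n with hh
  have hK0' : (0 : ℝ) < K := by exact_mod_cast hK0
  have hheq : h = ε / (3 * L * K) := by rw [hh, bandwidth, hKe]
  have hh0 : 0 < h := by rw [hheq]; positivity
  have hprob := hass.isProbabilityMeasure
  set P := featureLaw p with hP
  set μ := pmin * ρ * ω * h ^ d with hμ
  have hμ0 : 0 < μ := by positivity
  have hae𝒳 : ∀ᵐ z ∂P, z ∈ 𝒳 := hass.supported
  have haeμ : ∀ᵐ z ∂P, μ ≤ P.real (Metric.ball z h) :=
    hae𝒳.mono fun z hz => featureLaw_real_ball_ge hass hpmin hρ hh0 hhr hz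
  obtain ⟨k, rfl⟩ : ∃ k, n = k + 1 := ⟨n - 1, by omega⟩
  -- Since t^{d+1} = k + 1, the bound on μ t^d gives (k + 1) μ ≥ b t; the loss of the vertex itself
  -- costs a factor 2, as k ≥ 1.
  have hkμ : b * t / 2 ≤ k * μ := by
    have h1 : ε / (3 * L * A) / t ≤ h := by
      rw [hheq, div_div, mul_assoc (3 * L)]
      refine div_le_div_of_nonneg_left hε.le (by positivity) ?_
      exact mul_le_mul_of_nonneg_left hKt (by positivity)
    have h2 : (ε / (3 * L * A)) ^ d ≤ h ^ d * t ^ d := by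
      rw [← mul_pow]
      refine pow_le_pow_left₀ (by positivity) ?_ d
      rwa [div_le_iff₀ (by linarith)] at h1
    have h3 : b ≤ μ * t ^ d := by
      rw [hb, hμ, mul_assoc _ (h ^ d)]
      exact mul_le_mul_of_nonneg_left h2 (by positivity)
    have h4 : t ^ d * t = k + 1 := by
      rw [← pow_succ, ht, diffusionTime_pow]; push_cast; rfl
    have h5 : (1 : ℝ) ≤ k := by exact_mod_cast (by omega : 1 ≤ k)
    have h6 : b * t ≤ μ * (k + 1) := by
      rw [← h4, ← mul_assoc]
      exact mul_le_mul_of_nonneg_right h3 (by linarith)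
    nlinarith
  let D : Set (Fin (k + 1) → Feature d) := ⋃ i, {x | degree h x i ≤ k * μ / 2}
  have hDm : MeasurableSet D :=
    MeasurableSet.iUnion fun i => measurableSet_le (measurable_degree h i) measurable_const
  have hDle : (Measure.pi fun _ : Fin (k + 1) => P) D ≤
      ENNReal.ofReal ((k + 1 : ℕ) * Real.exp (-(b / 20 * t))) := by
    rw [← ofReal_measureReal]
    refine ENNReal.ofReal_le_ofReal ((measureReal_iUnion_fintype_le _).trans ?_)
    calc _ ≤ ∑ _i : Fin (k + 1), Real.exp (-(b / 20 * t)) := by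
          refine Finset.sum_le_sum fun i _ =>
            (measureReal_degree_le P haeμ hμ0.le i).trans (Real.exp_le_exp.mpr ?_)
          linarith
      _ = _ := by simp
  have hbt : 0 < b * t / 4 := by positivity
  have hgood : ∀ᵐ x ∂(Measure.pi fun _ : Fin (k + 1) => P), x ∉ D →
      queriesKernel κ (k + 1) m x {w | (x, w) ∈ failure κ ε L (k + 1) m} ≤
        ENNReal.ofReal (3 * (k + 1 : ℕ) * C *
          Real.exp (-(m * (t / (k + 1 : ℕ)) * η ^ 2 / (4 * g)))) := by
    have hall : ∀ᵐ x ∂(Measure.pi fun _ : Fin (k + 1) => P), ∀ i, x i ∈ 𝒳 :=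
      ae_all_iff.mpr fun i =>
        (Measure.quasiMeasurePreserving_eval (fun _ : Fin (k + 1) => P) i).ae hae𝒳
    filter_upwards [hall] with x hx hxD
    have hdeg : ∀ i, b * t / 4 ≤ degree h x i := by
      intro i
      by_contra! hlt
      refine hxD (Set.mem_iUnion.mpr ⟨i, ?_⟩)
      rw [Set.mem_ofPred_eq]
      linarith
    have hdeg0 : ∀ i, 0 < degree h x i := fun i => hbt.trans_le (hdeg i)
    have hS1 : ∀ i, ∑ j, transition h x i j = 1 := fun i => transition_row_sum_eq (hdeg0 i)
    have hG : ∀ i j, heatKernel α h x i j ≤ g := by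
      intro i j
      refine (resolvent_apply_le transition_nonneg hS1 hα0 hα1
        (fun i j => transition_le hbt (hdeg i) j) i j).trans_eq ?_
      rw [hαt, hg]
      field_simp
    have hbias : ∀ q, ‖∑ i, heatKernel α h x q i • (softLabel κ (x i) - softLabel κ (x q))‖
        ≤ (1 - α)⁻¹ * (5 * ε / 12) := by
      intro q
      refine (norm_sum_resolvent_smul_le transition_nonneg hS1 hα0 hα1 (a := ε / 3) (b := √2)
        (K := K) (by positivity) (fun l hl i hi => ?_) fun i => ?_).trans ?_
      · have h1 := norm_sub_le_of_transition_pow_ne_zero l hi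
        rw [norm_sub_rev]
        refine (hass.lipschitz _ (hx q) _ (hx i)).trans ?_
        have h2 : (l : ℝ) ≤ K := by exact_mod_cast hl.le
        calc L * ‖x q - x i‖ ≤ L * (K * h) := by
              refine mul_le_mul_of_nonneg_left (h1.trans ?_) hL.le
              exact mul_le_mul_of_nonneg_right h2 hh0.le
          _ = ε / 3 := by rw [hheq]; field_simp
      · exact norm_sub_le_sqrt_two (softLabel_nonneg κ _) (softLabel_nonneg κ _)
          (sum_softLabel κ _) (sum_softLabel κ _)
      -- Short walks contribute ε/3 and the tail c√2 = ε/12, together 5ε/12.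
      · refine mul_le_mul_of_nonneg_left ?_ (by rw [hαt]; linarith)
        have h1 : α ^ K * √2 ≤ c * √2 := mul_le_mul_of_nonneg_right hKα (Real.sqrt_nonneg _)
        have h2 : c * √2 = ε / 12 := by rw [hc]; field_simp
        linarith
    have := measure_failure_section_le (m := m) κ hC hε hα0 hα1 hg0 hdeg0 hG hbias hη0.le
      (min_le_left _ _) hηC
    rw [hαt] at this
    exact this
  refine (sampleLaw_le_add P κ (measurableSet_failure κ ε L _ m) hDm hgood).trans ?_
  refine (add_le_add hDle le_rfl).trans ?_
  rw [← ENNReal.ofReal_add (by positivity) (by positivity)]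
  refine ENNReal.ofReal_le_ofReal (add_le_add ?_ ?_)
  · gcongr
    rw [neg_mul]
    exact neg_le_neg (mul_le_mul_of_nonneg_right (min_le_left _ _) (by linarith))
  · gcongr
    rw [neg_mul]
    refine neg_le_neg ?_
    calc _ ≤ η ^ 2 / (4 * g) * (m * t / (k + 1 : ℕ)) := by
          gcongr
          exact min_le_right _ _
      _ = _ := by ring

end Failure

/-! ### Comparison with the budget scale -/

section Budget

/-- `n^{1/(2(d+1))}`, the square root of the diffusion time. -/
noncomputable def sqrtTime (d n : ℕ) : ℝ := (n : ℝ) ^ (1 / (2 * ((d : ℝ) + 1)))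

theorem one_le_sqrtTime (d : ℕ) {n : ℕ} (hn : 1 ≤ n) : 1 ≤ sqrtTime d n :=
  Real.one_le_rpow (by exact_mod_cast hn) (by positivity)

theorem sqrtTime_sq (d n : ℕ) : sqrtTime d n ^ 2 = diffusionTime d n := by
  rw [sqrtTime, diffusionTime, ← Real.rpow_natCast, ← Real.rpow_mul (Nat.cast_nonneg n)]
  congr 1
  field_simp
  norm_num

theorem budgetScale_eq (d : ℕ) {n : ℕ} (hn : 1 ≤ n) : budgetScale d n = n / sqrtTime d n := by
  rw [budgetScale, Real.rpow_sub (by exact_mod_cast hn), Real.rpow_one, sqrtTime]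

theorem rpow_one_add_eq (d : ℕ) {n : ℕ} (hn : 1 ≤ n) :
    (n : ℝ) ^ (1 + 1 / (2 * ((d : ℝ) + 1))) = n * sqrtTime d n := by
  rw [Real.rpow_add (by exact_mod_cast hn), Real.rpow_one, sqrtTime]

theorem tendsto_log_div_sqrtTime (d : ℕ) :
    Tendsto (fun n : ℕ => Real.log n / sqrtTime d n) atTop (𝓝 0) :=
  (isLittleO_log_rpow_atTop (r := 1 / (2 * ((d : ℝ) + 1)))
    (by positivity)).tendsto_div_nhds_zero.comp tendsto_natCast_atTop_atTop

theorem tendsto_ceil_budget_div (d : ℕ) {K : ℝ} (hK : 0 < K) :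
    Tendsto (fun n : ℕ => (⌈K * budgetScale d n * Real.log n⌉₊ : ℝ) / n) atTop (𝓝 0) := by
  have hlim : Tendsto (fun n : ℕ => K * (Real.log n / sqrtTime d n) + 1 / (n : ℝ))
      atTop (𝓝 0) := by
    simpa using ((tendsto_log_div_sqrtTime d).const_mul K).add
      (tendsto_const_div_atTop_nhds_zero_nat (1 : ℝ))
  refine tendsto_of_tendsto_of_tendsto_of_le_of_le' tendsto_const_nhds hlim
    (Eventually.of_forall fun n => by positivity) ?_
  filter_upwards [eventually_ge_atTop 1] with n hn
  have hn0 : (0 : ℝ) < n := by exact_mod_cast hn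
  have hs := one_le_sqrtTime d hn
  have hlog : 0 ≤ Real.log n := Real.log_natCast_nonneg n
  rw [budgetScale_eq d hn, div_le_iff₀ hn0]
  refine (Nat.ceil_lt_add_one (by positivity)).le.trans_eq ?_
  field_simp

/-- As n = t^{d+1}, this is a polynomial in t against exp(-a t). -/
theorem tendsto_mul_exp_neg_diffusionTime (d : ℕ) {a : ℝ} (ha : 0 < a) :
    Tendsto (fun n : ℕ => (n : ℝ) * Real.exp (-a * diffusionTime d n)) atTop (𝓝 0) := by
  have h := (tendsto_rpow_mul_exp_neg_mul_atTop_nhds_zero ((d + 1 : ℕ) : ℝ) a ha).comp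
    (tendsto_diffusionTime d)
  refine h.congr fun n => ?_
  simp only [Function.comp]
  rw [Real.rpow_natCast, diffusionTime_pow]

end Budget

end PLS

/-! ### The two budget regimes -/

theorem theorem1 (d C : ℕ) (hd : 1 ≤ d) (hC : 1 ≤ C) (ε L pmin pmax ρ r₀ : ℝ)
    (hε : 0 < ε) (hL : 0 < L) (hpmin : 0 < pmin) (hpmax : 0 < pmax) (hρ : 0 < ρ) (hr₀ : 0 < r₀) :
    Tendsto (fun n : ℕ => PLS.spreadingIntensity d n) atTop (𝓝 1) ∧
    Tendsto (fun n : ℕ => PLS.bandwidth d ε L n) atTop (𝓝 0) ∧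
    (∃ ζ : ℝ, 0 < ζ ∧ ∃ N : ℕ, ∀ n : ℕ, N ≤ n →
      ∀ m : ℕ, (m : ℝ) ≤ (n : ℝ) ^ (1 + 1 / (2 * ((d : ℝ) + 1))) →
      ∀ (𝒳 : Set (PLS.Feature d)) (p : PLS.Feature d → ℝ)
        (κ : Kernel (PLS.Feature d) (Fin C)) [IsMarkovKernel κ],
        PLS.Assumptions 𝒳 p κ pmin pmax ρ r₀ L →
        PLS.sampleLaw (PLS.featureLaw p) κ n m (PLS.failure κ ε L n m) ≤
          ENNReal.ofReal (12 * n * C * Real.exp (-ζ * (m / PLS.budgetScale d n)))) ∧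
    (∃ K : ℝ, 0 < K ∧
      Tendsto (fun n : ℕ => (⌈K * PLS.budgetScale d n * Real.log n⌉₊ : ℝ) / n) atTop (𝓝 0) ∧
      ∀ δ : ℝ, 0 < δ → δ < 1 → ∃ N : ℕ, ∀ n : ℕ, N ≤ n →
      ∀ m : ℕ, K * PLS.budgetScale d n * Real.log n ≤ (m : ℝ) →
      ∀ (𝒳 : Set (PLS.Feature d)) (p : PLS.Feature d → ℝ)
        (κ : Kernel (PLS.Feature d) (Fin C)) [IsMarkovKernel κ],
        PLS.Assumptions 𝒳 p κ pmin pmax ρ r₀ L →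
        PLS.sampleLaw (PLS.featureLaw p) κ n m (PLS.failure κ ε L n m) ≤
          ENNReal.ofReal δ) := by
  refine ⟨PLS.tendsto_spreadingIntensity d, PLS.tendsto_bandwidth d ε L hε, ?_⟩
  obtain ⟨a, ha, N₀, hN₀, hbound⟩ :=
    PLS.exists_failure_bound (d := d) (pmax := pmax) hC hε hL hpmin hρ hr₀
  have hC1 : (1 : ℝ) ≤ C := by exact_mod_cast hC
  constructor
  · refine ⟨a, ha, N₀, fun n hn m hm 𝒳 p κ _ hass => ?_⟩
    refine (hbound n hn m 𝒳 p κ hass).trans (ENNReal.ofReal_le_ofReal ?_)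
    have hn1 : 1 ≤ n := hN₀.trans hn
    have hn0 : (0 : ℝ) < n := by exact_mod_cast hn1
    have hs := PLS.one_le_sqrtTime d hn1
    rw [PLS.rpow_one_add_eq d hn1] at hm
    rw [PLS.budgetScale_eq d hn1, ← PLS.sqrtTime_sq d n]
    set s := PLS.sqrtTime d n
    set E := Real.exp (-a * (m / (n / s))) with hE
    have hr : (m : ℝ) / (n / s) = m / n * s := by field_simp
    have hmn : (m : ℝ) / n ≤ s := by rw [div_le_iff₀ hn0]; linarith
    have hmn0 : 0 ≤ (m : ℝ) / n := by positivity
    -- The cap m ≤ n s enters only here: it gives (m/n) s ≤ s² = t, so the degree term is dominated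
    -- too. The query term has a spare factor s ≥ 1.
    have h1 : Real.exp (-a * s ^ 2) ≤ E := by
      rw [hE, hr, Real.exp_le_exp, neg_mul, neg_mul]
      refine neg_le_neg (mul_le_mul_of_nonneg_left ?_ ha.le)
      nlinarith
    have h2 : Real.exp (-a * (m * s ^ 2 / n)) ≤ E := by
      rw [hE, hr, Real.exp_le_exp, neg_mul, neg_mul]
      refine neg_le_neg (mul_le_mul_of_nonneg_left ?_ ha.le)
      have h3 : (m : ℝ) * s ^ 2 / n = m / n * s * s := by ring
      rw [h3]
      exact le_mul_of_one_le_right (by positivity) hs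
    have hE0 : 0 < E := Real.exp_pos _
    calc _ ≤ (n : ℝ) * E + 3 * n * C * E := by gcongr
      _ ≤ _ := by
        have : 0 < (n : ℝ) * E := by positivity
        nlinarith
  -- With K = 2/a the query exponent is at least 2 log n, and n⁻² beats the factor n of the union
  -- bound, leaving 3C/n.
  · have hK : 0 < 2 / a := by positivity
    refine ⟨2 / a, hK, PLS.tendsto_ceil_budget_div d hK, fun δ hδ _ => ?_⟩
    have hlim : Tendsto (fun n : ℕ => (n : ℝ) * Real.exp (-a * PLS.diffusionTime d n)
        + 3 * C / (n : ℝ)) atTop (𝓝 0) := by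
      simpa using (PLS.tendsto_mul_exp_neg_diffusionTime d ha).add
        (tendsto_const_div_atTop_nhds_zero_nat (3 * C : ℝ))
    obtain ⟨N₁, hN₁⟩ := eventually_atTop.mp (hlim.eventually (gt_mem_nhds hδ))
    refine ⟨max N₀ N₁, fun n hn m hm 𝒳 p κ _ hass => ?_⟩
    have hn₀ : N₀ ≤ n := (le_max_left _ _).trans hn
    have hn1 : 1 ≤ n := hN₀.trans hn₀
    have hn0 : (0 : ℝ) < n := by exact_mod_cast hn1
    refine (hbound n hn₀ m 𝒳 p κ hass).trans (ENNReal.ofReal_le_ofReal ?_)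
    refine le_trans ?_ (hN₁ n ((le_max_right _ _).trans hn)).le
    refine add_le_add le_rfl ?_
    have hs := PLS.one_le_sqrtTime d hn1
    rw [PLS.budgetScale_eq d hn1] at hm
    rw [← PLS.sqrtTime_sq d n]
    set s := PLS.sqrtTime d n
    have hlog : 0 ≤ Real.log n := Real.log_natCast_nonneg n
    have h1 : 2 * Real.log n ≤ a * (m * s ^ 2 / n) := by
      have h2 : 2 * Real.log n * n ≤ a * m * s := by
        have h3 : a * s * (2 / a * (n / s) * Real.log n) ≤ a * s * m :=
          mul_le_mul_of_nonneg_left hm (by positivity)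
        have h4 : a * s * (2 / a * (n / s) * Real.log n) = 2 * Real.log n * n := by field_simp
        linarith
      rw [← mul_div_assoc, le_div_iff₀ hn0]
      have h5 : 0 ≤ a * m * s := by positivity
      nlinarith
    have h6 : Real.exp (-a * (m * s ^ 2 / n)) ≤ ((n : ℝ) ^ 2)⁻¹ := by
      calc _ ≤ Real.exp (-(2 * Real.log n)) := by
            rw [Real.exp_le_exp, neg_mul]; exact neg_le_neg h1
        _ = _ := by
            rw [Real.exp_neg, two_mul, Real.exp_add, Real.exp_log hn0, sq]
    calc _ ≤ 3 * (n : ℝ) * C * ((n : ℝ) ^ 2)⁻¹ := by gcongr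
      _ = _ := by field_simp
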